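/- Truly random functions are single-effective-query negligibly unlearnable. Precisely: for every security parameter $\lambda\in\mathbb N$ let $\mathcal X_\lambda,\mathcal R_\lambda,\mathcal Y_\lambda$ be finite sets such that $|\mathcal R_\lambda|=2^\lambda$ for all $\lambda$ and $|\mathcal Y_\lambda|$ is superpolynomial in $\lambda$ (it eventually exceeds every polynomial in $\lambda$). Let $\mathcal R_\lambda$ and $\mathcal Y_\lambda$ carry finite abelian group structures, written additively; for bit strings $+$ is the bitwise XOR. *The oracle.* For $f:\mathcal X\times\mathcal R\to\mathcal Y$, the single-effective-query (SEQ) oracle $f_{\$,1}$ keeps a register of databases $D$, i.e. partial functions $D:\mathcal X\rightharpoonup\mathcal R$, initialised to $|\emptyset\rangle$. Let $\mathsf{Decomp}_x$ be the unitary acting on the entry of $D$ at $x$ that exchanges $|\bot\rangle$ with $|\mathcal R|^{-1/2}\sum_{r}|r\rangle$ and is the identity on the orthogonal complement of these two vectors. A query of $x$ to the compressed random oracle $H$ is $\mathsf{Decomp}_x$, then $|v\rangle|D\rangle\mapsto|v+D(x)\rangle|D\rangle$ (the identity if $D(x)=\bot$), then $\mathsf{Decomp}_x$. On a basis state $|x,u,b\rangle|D\rangle$,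 with $x\in\mathcal X$, $u\in\mathcal Y$, $b\in\{0,1\}$, the oracle $f_{\$,1}$ does nothing if $D$ has an entry at some $x'\neq x$. Otherwise, coherently, it queries $x$ to $H$ with the response going to a fresh register $|0\rangle$ (which then holds $r$), applies $|x,u,b\rangle|r\rangle\mapsto|x,u+f(x,r),b\oplus1\rangle|r\rangle$, and uncomputes the query to $H$. *The game.* A function $f$ is sampled uniformly from all functions $\mathcal X_\lambda\times\mathcal R_\lambda\to\mathcal Y_\lambda$. A (non-uniform) quantum adversary, with a work register of any finite dimension, an arbitrary initial pure state independent of $f$, and arbitrary unitaries between its queries, interacts with $f_{\$,1}$, measures its registers, and outputs two triples $(x_1,r_1,y_1)$, $(x_2,r_2,y_2)$. It wins if $(x_1,r_1)\ne(x_2,r_2)$, $f(x_1,r_1)=y_1$ and $f(x_2,r_2)=y_2$. *Claim.* For every family $(\mathcal A_\lambda)_\lambda$ of such adversaries whose number of queries is bounded by a polynomial in $\lambda$ (they may otherwise be computationally unbounded; in particular for every non-uniform quantum polynomial-time adversary) there is a negligible function $\varepsilon$ such that for all $\lambda$ $$\Pr_{f,\mathcal A_\lambda}\bigl[\mathcal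 A_\lambda^{f_{\$,1}}\text{ wins}\bigr]\le\varepsilon(\lambda).$$ -/

import Mathlib

open Filter

noncomputable section

namespace SEQ

/-! ### Registers

All registers are finite. A pure state on registers with computational basis `S` is its vector of
amplitudes `S → ℂ`. The bitwise XOR on the register of outputs (and of random strings) is the
addition of a finite abelian group; for the group of bit strings, addition and subtraction are
both the XOR. -/

/-- Basis states `|x, u, b⟩` of the query register: an input `x`, a response register `u`, and the
bit `b` by which the oracle signals that it has answered. -/
abbrev Query (X Y : Type*) := X × Y × Bool

/-- A database `D`: a finite set of input/output pairs `(x, r)` with at most one pair for each `x`,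
that is, a partial function. `D x = some r` means `(x, r) ∈ D`, and `D x = none` means that nothing
is recorded at `x`. -/
abbrev Database (X R : Type*) := X → Option R

/-- Joint basis states: the private work register `W` of the adversary together with the query
register, then the internal response register of the oracle for queries to the random oracle `H`,
then the database register of the compressed oracle for `H`. -/
abbrev JointBasis (W X R Y : Type*) := (W × Query X Y) × R × Database X R

section Oracle

variable {W X R Y : Type*} [Fintype X] [DecidableEq X] [Fintype R] [DecidableEq R]
  [AddCommGroup R] [AddCommGroup Y]

/-- Matrix entries of the (de)compression unitary on one cell of the database. It swaps `|⊥⟩` with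
the uniform superposition `|R|^{-1/2} ∑ r, |r⟩` and is the identity on the orthogonal complement of
these two vectors:
`|⊥⟩ ↦ |R|^{-1/2} ∑ r, |r⟩` and `|r⟩ ↦ |r⟩ - |R|⁻¹ ∑ r', |r'⟩ + |R|^{-1/2} |⊥⟩`. -/
def decompCoeff : Option R → Option R → ℂ
  | none, none => 0
  | none, some _ => 1 / (Real.sqrt (Fintype.card R) : ℂ)
  | some _, none => 1 / (Real.sqrt (Fintype.card R) : ℂ)
  | some r, some r' => (if r = r' then 1 else 0) - 1 / (Fintype.card R : ℂ)

/-- The unitary `Decomp`: controlled on the queried input `x`, apply the (de)compression unitary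
to the cell `D x` of the database register. -/
def decomp (ψ : JointBasis W X R Y → ℂ) : JointBasis W X R Y → ℂ :=
  fun ⟨⟨w, x, u, b⟩, v, D⟩ =>
    ∑ e : Option R, decompCoeff (D x) e * ψ ((w, x, u, b), v, Function.update D x e)

/-- The unitary `|x⟩|v⟩|D⟩ ↦ |x⟩|v + D(x)⟩|D⟩`, and the identity where `D(x) = ⊥`. -/
def readCell (ψ : JointBasis W X R Y → ℂ) : JointBasis W X R Y → ℂ :=
  fun ⟨⟨w, x, u, b⟩, v, D⟩ => ψ ((w, x, u, b), v - (D x).getD 0, D)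

/-- The inverse of `readCell`: `|x⟩|v⟩|D⟩ ↦ |x⟩|v - D(x)⟩|D⟩`. -/
def unreadCell (ψ : JointBasis W X R Y → ℂ) : JointBasis W X R Y → ℂ :=
  fun ⟨⟨w, x, u, b⟩, v, D⟩ => ψ ((w, x, u, b), v + (D x).getD 0, D)

/-- A query to the compressed random oracle `H : X → R` on the input `x` of the query register,
with the response going to the internal register. -/
def queryH (ψ : JointBasis W X R Y → ℂ) : JointBasis W X R Y → ℂ :=
  decomp (readCell (decomp ψ))

/-- The uncomputation of a query to the compressed random oracle `H`. -/
def unqueryH (ψ : JointBasis W X R Y → ℂ) : JointBasis W X R Y → ℂ :=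
  decomp (unreadCell (decomp ψ))

/-- The evaluation step `|x, u, b⟩|r⟩ ↦ |x, u + f(x; r), b ⊕ 1⟩|r⟩`. -/
def evalStep (f : X × R → Y) (ψ : JointBasis W X R Y → ℂ) : JointBasis W X R Y → ℂ :=
  fun ⟨⟨w, x, u, b⟩, r, D⟩ => ψ ((w, x, u - f (x, r), !b), r, D)

/-- The database holds an entry `(x', r)` for some `x' ≠ x`. -/
def RecordsOther (D : Database X R) (x : X) : Prop :=
  ∃ x' : X, x' ≠ x ∧ ∃ r : R, D x' = some r

open Classical in
/-- One query to the single-effective-query oracle of `f`. On basis states `|x, u, b⟩|D⟩` for which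
`D` holds an entry at an input other than `x` it does nothing. On the others it queries the
compressed random oracle `H` at `x`, evaluates `f` with the response as randomness while flipping
`b`, and uncomputes the query to `H`. (`decomp`, `readCell`, `unreadCell` and `evalStep` all preserve
`x` and the part of `D` outside of `x`, so this is the operation controlled on the check. The
internal register starts as `|0⟩` and is returned to `|0⟩` by every query.) -/
def seqOracle (f : X × R → Y) (ψ : JointBasis W X R Y → ℂ) : JointBasis W X R Y → ℂ :=
  fun s => if RecordsOther s.2.2 s.1.2.1 then ψ s else unqueryH (evalStep f (queryH ψ)) s

end Oracle

section Game

variable (X R Y : Type*) [Fintype X] [DecidableEq X] [Fintype R] [DecidableEq R]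
  [Fintype Y] [DecidableEq Y] [AddCommGroup R] [AddCommGroup Y]

/-- A quantum oracle algorithm for the learning game, at one value of the security parameter. It is
computationally unbounded: it holds a work register of any finite dimension, starts from any pure
state (the advice), makes `queries` queries to the oracle, applies an arbitrary unitary to its work
and query registers after each of them (the `t`-th unitary after query number `t`, counting from
`0`; only those with `t < queries` are used), and finally measures its registers in the
computational basis and outputs two triples `(x₁, r₁, y₁)`, `(x₂, r₂, y₂)` as a function of the
outcome. -/
structure Adversary where
  /-- dimension of the work register -/
  dim : ℕ
  /-- number of oracle queries -/
  queries : ℕ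
  /-- initial state of the work register and the query register -/
  init : Fin dim × Query X Y → ℂ
  init_norm : ∑ a, ‖init a‖ ^ 2 = 1
  /-- the unitaries applied after the queries -/
  step : ℕ → Matrix.unitaryGroup (Fin dim × Query X Y) ℂ
  /-- the output, as a function of the outcome of the final measurement -/
  output : Fin dim × Query X Y → (X × R × Y) × (X × R × Y)

variable {X R Y}

/-- Apply a matrix to the adversary's registers, and the identity to the oracle's registers. -/
def applyLocal {A O : Type*} [Fintype A] (U : Matrix A A ℂ) (ψ : A × O → ℂ) : A × O → ℂ :=
  fun s => ∑ a, U s.1 a * ψ (a, s.2)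

/-- The joint state after `t` queries to the single-effective-query oracle of `f`. At the start the
internal response register is `|0⟩` and the database is empty. -/
def Adversary.state (A : Adversary X R Y) (f : X × R → Y) :
    ℕ → JointBasis (Fin A.dim) X R Y → ℂ
  | 0 => fun s => if s.2.1 = 0 ∧ s.2.2 = (fun _ => none) then A.init s.1 else 0
  | t + 1 => applyLocal (A.step t : Matrix _ _ ℂ) (seqOracle f (Adversary.state A f t))

/-- The challenger's check: the two inputs `(x₁, r₁)`, `(x₂, r₂)` are distinct, and both outputs are
correct. -/
def Wins (f : X × R → Y) (o : (X × R × Y) × (X × R × Y)) : Prop :=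
  (o.1.1, o.1.2.1) ≠ (o.2.1, o.2.2.1) ∧
    f (o.1.1, o.1.2.1) = o.1.2.2 ∧ f (o.2.1, o.2.2.1) = o.2.2.2

open Classical in
/-- The probability that the adversary wins when the function is `f`. -/
def Adversary.winProb (A : Adversary X R Y) (f : X × R → Y) : ℝ :=
  ∑ s : JointBasis (Fin A.dim) X R Y,
    if Wins f (A.output s.1) then ‖A.state f A.queries s‖ ^ 2 else 0

/-- The probability that the adversary wins the single-effective-query learning game in which the
function is sampled from `μ`. -/
def Adversary.gameProb (A : Adversary X R Y) (μ : PMF (X × R → Y)) : ℝ :=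
  ∑ f : X × R → Y, (μ f).toReal * A.winProb f

end Game

/-- A function is negligible if it tends to `0` faster than every inverse polynomial. -/
def Negligible (ε : ℕ → ℝ) : Prop :=
  Asymptotics.SuperpolynomialDecay atTop (fun n : ℕ => (n : ℝ)) ε

/-- A function is superpolynomial if it eventually exceeds every polynomial. -/
def Superpolynomial (g : ℕ → ℕ) : Prop :=
  ∀ p : Polynomial ℕ, ∀ᶠ n in atTop, p.eval n < g n

/-- Single-effective-query `negl`-unlearnability of a family of distributions `μ n` over functions
`X n × R n → Y n`, against all (non-uniform) adversaries with polynomially many queries; here `n` is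
the security parameter. -/
def Unlearnable {X R Y : ℕ → Type*} [∀ n, Fintype (X n)] [∀ n, DecidableEq (X n)]
    [∀ n, Fintype (R n)] [∀ n, DecidableEq (R n)] [∀ n, Fintype (Y n)] [∀ n, DecidableEq (Y n)]
    [∀ n, AddCommGroup (R n)] [∀ n, AddCommGroup (Y n)]
    (μ : ∀ n, PMF (X n × R n → Y n)) : Prop :=
  ∀ A : ∀ n, Adversary (X n) (R n) (Y n),
    (∃ p : Polynomial ℕ, ∀ n, (A n).queries ≤ p.eval n) →
      ∃ ε : ℕ → ℝ, Negligible ε ∧ ∀ n, (A n).gameProb (μ n) ≤ ε n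

end SEQ

end

/-! The database never holds more than one entry, so the oracle acts on states indexed by `Option (X
× R)`. Treat `f` as a further register in uniform superposition. In the ideal picture an empty
database goes with amplitudes independent of `f`, and the database `{(x, r)}` with amplitudes
depending on `f (x, r)` alone (`compressedSpace`). Of two distinct points claimed by the adversary,
one is then unrecorded; the value of `f` there is uniform and independent of the state, so winning
has weight at most `1/|Y|` (`card_mul_sum_wins_le`).

Evaluation and the adversary's unitaries respect this picture exactly. Decompression does not, since
it involves `∑ r, Φ (f, a, some (x, r))`, which depends on `f` at every `(x, r)`. But this is a sum
of independent random variables, so its variance is at most the sum of their second moments, and it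
enters with weight `1/√|R|`. Replacing it by its mean costs a relative error `√(2/|R|)`
(`norm_lift_redDecomp_sub_meanDecomp_le`). The errors add up over two decompressions per query
(`Adversary.exists_mem_compressedSpace`), giving the bound `2/|Y| + 16 q²/|R|` for `q` queries
(`Adversary.gameProb_uniform_le`). -/

set_option linter.unusedSectionVars false

open Filter

noncomputable section

namespace SEQ

/-! ### The (de)compression unitary on a single cell. -/

section Cell

variable {R : Type*} [Fintype R] [DecidableEq R]

/-- The (de)compression unitary on one cell. -/
def cellDecomp (φ : Option R → ℂ) : Option R → ℂ :=
  fun e => ∑ e', decompCoeff e e' * φ e'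

lemma cellDecomp_none (φ : Option R → ℂ) :
    cellDecomp φ none = 1 / (Real.sqrt (Fintype.card R) : ℂ) * ∑ r, φ (some r) := by
  simp [cellDecomp, Fintype.sum_option, decompCoeff, Finset.mul_sum]

lemma cellDecomp_some (φ : Option R → ℂ) (r : R) :
    cellDecomp φ (some r) = 1 / (Real.sqrt (Fintype.card R) : ℂ) * φ none +
      (φ (some r) - 1 / (Fintype.card R : ℂ) * ∑ r', φ (some r')) := by
  simp [cellDecomp, Fintype.sum_option, decompCoeff, Finset.mul_sum, sub_mul,
    Finset.sum_sub_distrib]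

lemma cellDecomp_sub (φ φ' : Option R → ℂ) :
    cellDecomp (φ - φ') = cellDecomp φ - cellDecomp φ' := by
  funext e
  simp [cellDecomp, mul_sub, Finset.sum_sub_distrib]

lemma cellDecomp_zero : cellDecomp (fun _ : Option R => (0 : ℂ)) = fun _ => 0 := by
  funext e
  simp [cellDecomp]

lemma inv_sqrt_card_mul_self [Nonempty R] :
    1 / (Real.sqrt (Fintype.card R) : ℂ) * (1 / (Real.sqrt (Fintype.card R) : ℂ)) =
      1 / (Fintype.card R : ℂ) := by
  rw [div_mul_div_comm, one_mul, ← Complex.ofReal_mul, Real.mul_self_sqrt (by positivity)]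
  simp

lemma cellDecomp_cellDecomp [Nonempty R] (φ : Option R → ℂ) :
    cellDecomp (cellDecomp φ) = φ := by
  have hc : (Fintype.card R : ℂ) ≠ 0 := by simp
  have hs := inv_sqrt_card_mul_self (R := R)
  funext e
  cases e with
  | none =>
    simp only [cellDecomp_none, cellDecomp_some, Finset.sum_add_distrib, Finset.sum_sub_distrib,
      Finset.sum_const, Finset.card_univ, nsmul_eq_mul]
    rw [mul_add, mul_left_comm, ← mul_assoc _ _ (φ none), hs]
    field_simp
    ring
  | some r =>
    simp only [cellDecomp_none, cellDecomp_some, Finset.sum_add_distrib, Finset.sum_sub_distrib,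
      Finset.sum_const, Finset.card_univ, nsmul_eq_mul]
    rw [← mul_assoc, hs]
    field_simp
    ring

lemma decompCoeff_comm (e e' : Option R) : decompCoeff e e' = decompCoeff e' e := by
  cases e <;> cases e' <;> simp [decompCoeff, eq_comm]

lemma star_decompCoeff (e e' : Option R) : star (decompCoeff e e') = decompCoeff e e' := by
  cases e <;> cases e' <;> simp [decompCoeff]

/-- The matrix is real, symmetric and an involution, hence unitary. -/
lemma sum_norm_sq_cellDecomp [Nonempty R] (φ : Option R → ℂ) :
    ∑ e, ‖cellDecomp φ e‖ ^ 2 = ∑ e, ‖φ e‖ ^ 2 := by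
  have key : ∑ e, star (cellDecomp φ e) * cellDecomp φ e = ∑ e, star (φ e) * φ e := by
    calc ∑ e, star (cellDecomp φ e) * cellDecomp φ e
        = ∑ e, ∑ e', star (φ e') * (decompCoeff e' e * cellDecomp φ e) := by
          refine Finset.sum_congr rfl fun e _ => ?_
          conv_lhs => enter [1]; rw [cellDecomp]
          rw [star_sum, Finset.sum_mul]
          refine Finset.sum_congr rfl fun e' _ => ?_
          rw [star_mul', star_decompCoeff, decompCoeff_comm]
          ring
      _ = ∑ e', star (φ e') * cellDecomp (cellDecomp φ) e' := by
          rw [Finset.sum_comm]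
          refine Finset.sum_congr rfl fun e' _ => ?_
          rw [← Finset.mul_sum]
          rfl
      _ = _ := by rw [cellDecomp_cellDecomp]
  have h : ∀ z : ℂ, star z * z = ((‖z‖ ^ 2 : ℝ) : ℂ) := fun z => by
    rw [Complex.star_def, Complex.conj_mul']
    push_cast
    rfl
  simp only [h] at key
  exact_mod_cast key

end Cell

/-! ### Reduction to databases with at most one entry. -/

section Reduced

variable {W X R Y : Type*} [Fintype X] [DecidableEq X] [Fintype R] [DecidableEq R]
  [AddCommGroup R] [AddCommGroup Y]

/-- The database with at most one entry that holds `e` at `x`. -/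
def cell (x : X) (e : Option R) : Option (X × R) := e.map (Prod.mk x)

@[simp] lemma cell_none (x : X) : cell x (none : Option R) = none := rfl

@[simp] lemma cell_some (x : X) (r : R) : cell x (some r) = some (x, r) := rfl

/-- Databases with at most one entry, as databases. -/
def toDatabase : Option (X × R) → Database X R
  | none => fun _ => none
  | some (x, r) => Function.update (fun _ => none) x (some r)

lemma toDatabase_cell (x : X) (e : Option R) :
    toDatabase (cell x e) = Function.update (fun _ => none) x e := by
  cases e <;> simp [toDatabase]

lemma toDatabase_injective : Function.Injective (toDatabase (X := X) (R := R)) := by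
  have h : ∀ (x : X) (r : R), toDatabase (some (x, r)) x = some r := by simp [toDatabase]
  rintro (_ | ⟨x, r⟩) (_ | ⟨x', r'⟩) hd
  · rfl
  · have := congrFun hd x'
    rw [h] at this
    simp [toDatabase] at this
  · have := congrFun hd x
    rw [h] at this
    simp [toDatabase] at this
  · have := congrFun hd x
    rw [h] at this
    by_cases hx : x = x'
    · subst hx
      rw [h] at this
      simp_all
    · simp [toDatabase, Function.update_of_ne hx] at this

lemma recordsOther_toDatabase_some {x x' : X} (r : R) :
    RecordsOther (toDatabase (some (x', r))) x ↔ x' ≠ x := by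
  constructor
  · rintro ⟨z, hz, s, hs⟩ rfl
    simp [toDatabase, Function.update_of_ne hz] at hs
  · intro h
    exact ⟨x', h, r, by simp [toDatabase]⟩

lemma not_recordsOther_toDatabase_none (x : X) :
    ¬ RecordsOther (toDatabase (none : Option (X × R))) x := by
  rintro ⟨z, -, s, hs⟩
  simp [toDatabase] at hs

lemma eq_toDatabase_cell {D : Database X R} {x : X} (h : ¬ RecordsOther D x) :
    D = toDatabase (cell x (D x)) := by
  rw [toDatabase_cell]
  funext z
  by_cases hz : z = x
  · subst hz
    simp
  · rw [Function.update_of_ne hz, Option.eq_none_iff_forall_ne_some]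
    exact fun r hr => h ⟨z, hz, r, hr⟩

/-- States of the adversary's registers and of a database with at most one entry, as joint states
whose internal response register is `|0⟩`. -/
def embed {A : Type*} (ψ : A × Option (X × R) → ℂ) : A × R × Database X R → ℂ :=
  fun s => Function.extend (fun d => ((0 : R), toDatabase d)) (fun d => ψ (s.1, d)) 0 s.2

lemma embedding_injective :
    Function.Injective (fun d : Option (X × R) => ((0 : R), toDatabase d)) :=
  fun _ _ h => toDatabase_injective (Prod.ext_iff.1 h).2

lemma embed_apply {A : Type*} (ψ : A × Option (X × R) → ℂ) (a : A) (d : Option (X × R)) :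
    embed ψ (a, 0, toDatabase d) = ψ (a, d) :=
  embedding_injective.extend_apply (fun d => ψ (a, d)) 0 d

lemma embed_of_forall_ne {A : Type*} (ψ : A × Option (X × R) → ℂ) (a : A)
    {o : R × Database X R} (h : ∀ d, ((0 : R), toDatabase d) ≠ o) : embed ψ (a, o) = 0 :=
  Function.extend_apply' _ _ _ (by simpa using h)

lemma embed_of_ne_zero {A : Type*} (ψ : A × Option (X × R) → ℂ) (a : A) {v : R} (hv : v ≠ 0)
    (D : Database X R) : embed ψ (a, v, D) = 0 :=
  embed_of_forall_ne ψ a fun _ h => hv (Prod.ext_iff.1 h).1.symm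

lemma embed_applyLocal {A : Type*} [Fintype A] (U : Matrix A A ℂ)
    (ψ : A × Option (X × R) → ℂ) : applyLocal U (embed ψ) = embed (applyLocal U ψ) := by
  funext ⟨a, o⟩
  by_cases h : ∃ d, ((0 : R), toDatabase d) = o
  · obtain ⟨d, rfl⟩ := h
    simp [applyLocal, embed_apply]
  · push Not at h
    simp [applyLocal, embed_of_forall_ne _ _ h]

lemma sum_embed {A : Type*} [Fintype A] (G : A → ℝ) (ψ : A × Option (X × R) → ℂ) :
    ∑ s, G s.1 * ‖embed ψ s‖ ^ 2 = ∑ s, G s.1 * ‖ψ s‖ ^ 2 := by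
  rw [Fintype.sum_prod_type, Fintype.sum_prod_type]
  refine Finset.sum_congr rfl fun a _ => ?_
  refine (Fintype.sum_of_injective _ embedding_injective _ _ ?_ ?_).symm
  · intro o ho
    rw [embed_of_forall_ne ψ a (by simpa using ho)]
    simp
  · intro d
    rw [embed_apply]

/-- The action of `decomp` on databases with at most one entry, restricted to the cell of the
queried input. -/
def redDecomp (ψ : (W × Query X Y) × Option (X × R) → ℂ) :
    (W × Query X Y) × Option (X × R) → ℂ
  | (a, none) => cellDecomp (fun e => ψ (a, cell a.2.1 e)) none
  | (a, some (x, r)) =>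
    if x = a.2.1 then cellDecomp (fun e => ψ (a, cell x e)) (some r) else ψ (a, some (x, r))

lemma redDecomp_cell (ψ : (W × Query X Y) × Option (X × R) → ℂ) (a : W × Query X Y)
    (e : Option R) :
    redDecomp ψ (a, cell a.2.1 e) = cellDecomp (fun e => ψ (a, cell a.2.1 e)) e := by
  cases e <;> simp [redDecomp]

lemma redDecomp_of_ne (ψ : (W × Query X Y) × Option (X × R) → ℂ) {a : W × Query X Y}
    {x : X} (r : R) (h : x ≠ a.2.1) : redDecomp ψ (a, some (x, r)) = ψ (a, some (x, r)) := by
  simp [redDecomp, h]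

/-- The evaluation of `f` on the recorded randomness, on databases with at most one entry. -/
def redEval (f : X × R → Y) (ψ : (W × Query X Y) × Option (X × R) → ℂ) :
    (W × Query X Y) × Option (X × R) → ℂ
  -- At `⊥` nothing is read, so the internal register still holds `0` and `f (x, 0)` is evaluated.
  -- This branch carries no amplitude on `decompressedSpace`.
  | ((w, x, u, b), none) => ψ ((w, x, u - f (x, 0), !b), none)
  | ((w, x, u, b), some (x', r)) =>
    if x' = x then ψ ((w, x, u - f (x, r), !b), some (x', r)) else ψ ((w, x, u, b), some (x', r))

lemma redEval_cell (f : X × R → Y) (ψ : (W × Query X Y) × Option (X × R) → ℂ) (w : W) (x : X)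
    (u : Y) (b : Bool) (e : Option R) :
    redEval f ψ ((w, x, u, b), cell x e) = ψ ((w, x, u - f (x, e.getD 0), !b), cell x e) := by
  cases e <;> simp [redEval]

/-- One query to the single-effective-query oracle, on databases with at most one entry. -/
def redOracle (f : X × R → Y) (ψ : (W × Query X Y) × Option (X × R) → ℂ) :
    (W × Query X Y) × Option (X × R) → ℂ :=
  redDecomp (redEval f (redDecomp ψ))

lemma decomp_decomp (ψ : JointBasis W X R Y → ℂ) : decomp (decomp ψ) = ψ := by
  funext ⟨⟨w, x, u, b⟩, v, D⟩
  have := congrFun (cellDecomp_cellDecomp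
    (fun e => ψ ((w, x, u, b), v, Function.update D x e))) (D x)
  simpa [decomp, cellDecomp] using this

lemma evalStep_decomp (f : X × R → Y) (ψ : JointBasis W X R Y → ℂ) :
    evalStep f (decomp ψ) = decomp (evalStep f ψ) := rfl

/-- Evaluation leaves `x` and the database alone, so it commutes with `decomp`, and the two inner
decompressions cancel. -/
lemma unqueryH_evalStep_queryH (f : X × R → Y) (ψ : JointBasis W X R Y → ℂ) :
    unqueryH (evalStep f (queryH ψ)) =
      decomp (unreadCell (evalStep f (readCell (decomp ψ)))) := by
  rw [unqueryH, queryH, evalStep_decomp, decomp_decomp]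

lemma decomp_toDatabase_cell (ψ : JointBasis W X R Y → ℂ) (w : W) (x : X) (u : Y) (b : Bool)
    (v : R) (e : Option R) :
    decomp ψ ((w, x, u, b), v, toDatabase (cell x e)) =
      cellDecomp (fun e' => ψ ((w, x, u, b), v, toDatabase (cell x e'))) e := by
  simp [decomp, cellDecomp, toDatabase_cell]

lemma unreadCell_evalStep_readCell (f : X × R → Y) (ψ : JointBasis W X R Y → ℂ) (w : W) (x : X)
    (u : Y) (b : Bool) (v : R) (e : Option R) :
    unreadCell (evalStep f (readCell ψ)) ((w, x, u, b), v, toDatabase (cell x e)) =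
      ψ ((w, x, u - f (x, v + e.getD 0), !b), v, toDatabase (cell x e)) := by
  simp [unreadCell, evalStep, readCell, toDatabase_cell]

/-- The check on other entries is what keeps the database from acquiring a second entry; the
internal register returns to `0` because reading and unreading the same cell cancel. -/
lemma seqOracle_embed (f : X × R → Y) (ψ : (W × Query X Y) × Option (X × R) → ℂ) :
    seqOracle f (embed ψ) = embed (redOracle f ψ) := by
  funext ⟨⟨w, x, u, b⟩, v, D⟩
  rw [seqOracle]
  split_ifs with h
  · by_cases hd : ∃ d, ((0 : R), toDatabase d) = (v, D)
    · obtain ⟨d, hd⟩ := hd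
      obtain ⟨rfl, rfl⟩ := Prod.ext_iff.1 hd
      rcases d with _ | ⟨x', r⟩
      · exact absurd h (not_recordsOther_toDatabase_none x)
      · have hx : x' ≠ x := (recordsOther_toDatabase_some r).1 h
        simp [embed_apply, redOracle, redDecomp, redEval, hx]
    · push Not at hd
      rw [embed_of_forall_ne _ _ hd, embed_of_forall_ne _ _ hd]
  · simp only at h
    rw [unqueryH_evalStep_queryH, eq_toDatabase_cell h, decomp_toDatabase_cell]
    simp only [unreadCell_evalStep_readCell, decomp_toDatabase_cell]
    by_cases hv : v = 0
    · subst hv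
      rw [embed_apply, redOracle, redDecomp_cell _ (w, x, u, b)]
      simp only [redEval_cell]
      simp only [embed_apply, zero_add]
      congr 1
      funext e
      exact (redDecomp_cell ψ (w, x, u - f (x, e.getD 0), !b) e).symm
    · simp only [embed_of_ne_zero _ _ hv, cellDecomp_zero]

/-- The joint state of the adversary and of a database with at most one entry after `t` queries. -/
def Adversary.redState [Fintype Y] [DecidableEq Y] (A : Adversary X R Y) (f : X × R → Y) :
    ℕ → (Fin A.dim × Query X Y) × Option (X × R) → ℂ
  | 0 => fun s => if s.2 = none then A.init s.1 else 0
  | t + 1 => applyLocal (A.step t : Matrix _ _ ℂ) (redOracle f (Adversary.redState A f t))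

lemma Adversary.state_eq_embed [Fintype Y] [DecidableEq Y] (A : Adversary X R Y)
    (f : X × R → Y) (t : ℕ) : A.state f t = embed (A.redState f t) := by
  induction t with
  | zero =>
    funext ⟨a, v, D⟩
    simp only [Adversary.state]
    by_cases hd : ∃ d, ((0 : R), toDatabase d) = (v, D)
    · obtain ⟨d, hd⟩ := hd
      obtain ⟨rfl, rfl⟩ := Prod.ext_iff.1 hd
      have : toDatabase d = (fun _ => none) ↔ d = none :=
        toDatabase_injective.eq_iff' (b := none) rfl
      simp [embed_apply, this, Adversary.redState]
    · push Not at hd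
      rw [embed_of_forall_ne _ _ hd, if_neg]
      rintro ⟨h0, hD⟩
      exact hd none (Prod.ext h0.symm hD.symm)
  | succ t ih =>
    rw [Adversary.state, ih, seqOracle_embed, embed_applyLocal, Adversary.redState]

lemma Adversary.winProb_eq [Fintype Y] [DecidableEq Y] (A : Adversary X R Y)
    (f : X × R → Y) : A.winProb f =
      ∑ s, {o | Wins f o}.indicator 1 (A.output s.1) * ‖A.redState f A.queries s‖ ^ 2 := by
  rw [← sum_embed (fun a => {o | Wins f o}.indicator (1 : (X × R × Y) × (X × R × Y) → ℝ) (A.output a)),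
    Adversary.winProb, Adversary.state_eq_embed]
  refine Finset.sum_congr rfl fun s _ => ?_
  by_cases h : Wins f (A.output s.1) <;> simp [h]

/-! ### Isometries -/

/-- Separates the databases on which a query to `x` acts from those on which it is the identity. -/
lemma sum_option_prod (x : X) (F : Option (X × R) → ℝ) :
    ∑ d, F d = ∑ e, F (cell x e) + ∑ x', ∑ r, if x' = x then 0 else F (some (x', r)) := by
  rw [Fintype.sum_option, Fintype.sum_option, Fintype.sum_prod_type, add_assoc, cell_none]
  congr 1
  have h : ∑ r, F (cell x (some r)) = ∑ x', ∑ r, if x' = x then F (some (x', r)) else 0 := by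
    rw [Finset.sum_eq_single x]
    · simp
    · intro x' _ hx
      simp [hx]
    · simp
  rw [h, ← Finset.sum_add_distrib]
  refine Finset.sum_congr rfl fun x' _ => ?_
  rw [← Finset.sum_add_distrib]
  refine Finset.sum_congr rfl fun r _ => ?_
  split_ifs <;> simp

lemma redDecomp_sub (ψ φ : (W × Query X Y) × Option (X × R) → ℂ) :
    redDecomp (ψ - φ) = redDecomp ψ - redDecomp φ := by
  funext ⟨a, d⟩
  rcases d with _ | ⟨x, r⟩
  · exact congrFun (cellDecomp_sub (fun e => ψ (a, cell a.2.1 e)) _) none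
  · by_cases h : x = a.2.1
    · subst h
      have := congrFun (cellDecomp_sub (fun e => ψ (a, cell a.2.1 e)) fun e => φ (a, cell a.2.1 e))
        (some r)
      simpa [redDecomp, Pi.sub_def] using this
    · simp [redDecomp, h]

lemma redEval_sub (f : X × R → Y) (ψ φ : (W × Query X Y) × Option (X × R) → ℂ) :
    redEval f (ψ - φ) = redEval f ψ - redEval f φ := by
  funext ⟨⟨w, x, u, b⟩, d⟩
  rcases d with _ | ⟨x', r⟩
  · rfl
  · by_cases h : x' = x <;> simp [redEval, h]

lemma applyLocal_sub {A O : Type*} [Fintype A] (U : Matrix A A ℂ) (ψ φ : A × O → ℂ) :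
    applyLocal U (ψ - φ) = applyLocal U ψ - applyLocal U φ := by
  funext s
  simp [applyLocal, mul_sub, Finset.sum_sub_distrib]

lemma sum_prod_congr {A O : Type*} [Fintype A] [Fintype O] {F G : A × O → ℝ}
    (h : ∀ a, ∑ o, F (a, o) = ∑ o, G (a, o)) : ∑ s, F s = ∑ s, G s := by
  rw [Fintype.sum_prod_type, Fintype.sum_prod_type]
  exact Finset.sum_congr rfl fun a _ => h a

lemma sum_norm_sq_redDecomp [Fintype W] [Fintype Y]
    (ψ : (W × Query X Y) × Option (X × R) → ℂ) :
    ∑ s, ‖redDecomp ψ s‖ ^ 2 = ∑ s, ‖ψ s‖ ^ 2 := by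
  refine sum_prod_congr fun a => ?_
  rw [sum_option_prod a.2.1, sum_option_prod a.2.1]
  congr 1
  · simp only [redDecomp_cell]
    exact sum_norm_sq_cellDecomp _
  · refine Finset.sum_congr rfl fun x _ => Finset.sum_congr rfl fun r _ => ?_
    split_ifs with h
    · rfl
    · rw [redDecomp_of_ne _ _ h]

/-- The permutation of the response registers by an evaluation of `f`. -/
def evalEquiv (f : X × R → Y) : Equiv.Perm ((W × Query X Y) × Option (X × R)) where
  toFun
    | ((w, x, u, b), none) => ((w, x, u - f (x, 0), !b), none)
    | ((w, x, u, b), some (x', r)) =>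
      if x' = x then ((w, x, u - f (x, r), !b), some (x', r)) else ((w, x, u, b), some (x', r))
  invFun
    | ((w, x, u, b), none) => ((w, x, u + f (x, 0), !b), none)
    | ((w, x, u, b), some (x', r)) =>
      if x' = x then ((w, x, u + f (x, r), !b), some (x', r)) else ((w, x, u, b), some (x', r))
  left_inv := by
    rintro ⟨⟨w, x, u, b⟩, _ | ⟨x', r⟩⟩
    · simp
    · by_cases h : x' = x <;> simp [h]
  right_inv := by
    rintro ⟨⟨w, x, u, b⟩, _ | ⟨x', r⟩⟩
    · simp
    · by_cases h : x' = x <;> simp [h]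

lemma redEval_eq (f : X × R → Y) (ψ : (W × Query X Y) × Option (X × R) → ℂ) :
    redEval f ψ = ψ ∘ evalEquiv f := by
  funext ⟨⟨w, x, u, b⟩, d⟩
  rcases d with _ | ⟨x', r⟩
  · rfl
  · by_cases h : x' = x <;> simp [redEval, evalEquiv, h]

lemma sum_norm_sq_redEval [Fintype W] [Fintype Y] (f : X × R → Y)
    (ψ : (W × Query X Y) × Option (X × R) → ℂ) :
    ∑ s, ‖redEval f ψ s‖ ^ 2 = ∑ s, ‖ψ s‖ ^ 2 := by
  rw [redEval_eq]
  exact Equiv.sum_comp (evalEquiv f) fun s => ‖ψ s‖ ^ 2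

lemma sum_norm_sq_mulVec {A : Type*} [Fintype A] [DecidableEq A]
    (U : Matrix.unitaryGroup A ℂ) (φ : A → ℂ) :
    ∑ a, ‖Matrix.mulVec (U : Matrix A A ℂ) φ a‖ ^ 2 = ∑ a, ‖φ a‖ ^ 2 := by
  have h : ∀ χ : A → ℂ, ((∑ a, ‖χ a‖ ^ 2 : ℝ) : ℂ) = star χ ⬝ᵥ χ := fun χ => by
    simp [dotProduct, Complex.conj_mul']
  have key : star (Matrix.mulVec (U : Matrix A A ℂ) φ) ⬝ᵥ Matrix.mulVec (U : Matrix A A ℂ) φ =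
      star φ ⬝ᵥ φ := by
    rw [Matrix.star_mulVec, Matrix.dotProduct_mulVec, Matrix.vecMul_vecMul,
      ← Matrix.star_eq_conjTranspose, Unitary.coe_star_mul_self, Matrix.vecMul_one]
  rw [← h, ← h] at key
  exact_mod_cast key

lemma sum_norm_sq_applyLocal {A O : Type*} [Fintype A] [DecidableEq A] [Fintype O]
    (U : Matrix.unitaryGroup A ℂ) (ψ : A × O → ℂ) :
    ∑ s, ‖applyLocal (U : Matrix A A ℂ) ψ s‖ ^ 2 = ∑ s, ‖ψ s‖ ^ 2 := by
  rw [Fintype.sum_prod_type_right, Fintype.sum_prod_type_right]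
  exact Finset.sum_congr rfl fun o _ => sum_norm_sq_mulVec U fun a => ψ (a, o)

end Reduced

/-! ### Independence of the values of a uniform random function. -/

section Independence

variable {K Y : Type*} [Fintype K] [DecidableEq K] [Fintype Y]

/-- A function of `f k` and a function that does not depend on `f k` are independent. -/
lemma card_mul_sum_mul {S : Type*} [CommSemiring S] (k : K) (A B : (K → Y) → S)
    (hA : ∀ f f', f k = f' k → A f = A f') (hB : ∀ f y, B (Function.update f k y) = B f) :
    (Fintype.card (K → Y) : S) * ∑ f, A f * B f = (∑ f, A f) * ∑ f, B f := by
  -- Exchanging the values at `k` of two independent functions turns `A f * B f'` into `A f' * B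
  -- f'`.
  let σ : (K → Y) × (K → Y) → (K → Y) × (K → Y) :=
    fun q => (Function.update q.1 k (q.2 k), Function.update q.2 k (q.1 k))
  have hσ : Function.Involutive σ := fun q => by simp [σ]
  rw [Fintype.sum_mul_sum, ← Fintype.sum_prod_type' fun f f' => A f * B f',
    ← Equiv.sum_comp (hσ.toPerm σ)]
  have h : ∀ q : (K → Y) × (K → Y), A (hσ.toPerm σ q).1 * B (hσ.toPerm σ q).2 = A q.2 * B q.2 :=
    fun q => by
      change A (Function.update q.1 k (q.2 k)) * B (Function.update q.2 k (q.1 k)) = _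
      rw [hB, hA _ q.2 (by simp)]
  simp only [h]
  rw [Fintype.sum_prod_type]
  simp

/-- Exchanging `f k` with a fresh uniform element of `Y` shows that the event `f k = y` has
probability `1/|Y|`, independently of `B`. -/
lemma card_mul_sum_ite [DecidableEq Y] {S : Type*} [CommSemiring S] (k : K) (y : Y)
    (B : (K → Y) → S) (hB : ∀ f y, B (Function.update f k y) = B f) :
    (Fintype.card Y : S) * ∑ f, (if f k = y then B f else 0) = ∑ f, B f := by
  let σ : (K → Y) × Y → (K → Y) × Y := fun q => (Function.update q.1 k q.2, q.1 k)
  have hσ : Function.Involutive σ := fun q => by simp [σ]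
  have h : ∑ q : (K → Y) × Y, (if q.1 k = y then B q.1 else 0) =
      ∑ q : (K → Y) × Y, (if q.2 = y then B q.1 else 0) := by
    rw [← Equiv.sum_comp (hσ.toPerm σ)]
    refine Finset.sum_congr rfl fun q _ => ?_
    change (if Function.update q.1 k q.2 k = y then B (Function.update q.1 k q.2) else 0) = _
    rw [hB, Function.update_self]
  rw [Fintype.sum_prod_type, Fintype.sum_prod_type] at h
  simpa [Finset.mul_sum] using h

/-- A variance is at most the second moment. -/
lemma sum_norm_sq_sub_mean_le {F : Type*} [Fintype F] [Nonempty F] (g : F → ℂ) :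
    ∑ f, ‖g f - (∑ f', g f') / Fintype.card F‖ ^ 2 ≤ ∑ f, ‖g f‖ ^ 2 := by
  set c : ℂ := (∑ f', g f') / Fintype.card F with hc
  have hs : ∑ f', g f' = Fintype.card F * c := by
    rw [hc]
    field_simp
  have key : ((∑ f, ‖g f - c‖ ^ 2 : ℝ) : ℂ) =
      ((∑ f, ‖g f‖ ^ 2 - Fintype.card F * ‖c‖ ^ 2 : ℝ) : ℂ) := by
    push_cast
    simp only [← Complex.conj_mul', map_sub, sub_mul, mul_sub, Finset.sum_sub_distrib,
      ← Finset.mul_sum, ← Finset.sum_mul, ← map_sum, hs]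
    simp
    ring
  have key' := Complex.ofReal_injective key
  rw [key']
  have : 0 ≤ (Fintype.card F : ℝ) * ‖c‖ ^ 2 := by positivity
  linarith

/-- Centred functions of distinct coordinates are orthogonal, so Pythagoras applies. -/
lemma sum_norm_sq_sum_eq {J : Type*} [Fintype J] [Nonempty Y] (p : J → K)
    (hp : Function.Injective p) (h : (K → Y) → J → ℂ)
    (hdep : ∀ j f f', f (p j) = f' (p j) → h f j = h f' j) (hsum : ∀ j, ∑ f, h f j = 0) :
    ∑ f, ‖∑ j, h f j‖ ^ 2 = ∑ f, ∑ j, ‖h f j‖ ^ 2 := by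
  classical
  have cross : ∀ i j, i ≠ j → ∑ f, (starRingEnd ℂ) (h f i) * h f j = 0 := by
    intro i j hij
    have := card_mul_sum_mul (p j) (fun f => h f j) (fun f => (starRingEnd ℂ) (h f i))
      (hdep j) (fun f y => by
        rw [hdep i (Function.update f (p j) y) f
          (Function.update_of_ne (fun e => hij (hp e)) _ _)])
    rw [hsum, zero_mul, mul_eq_zero] at this
    simp_rw [mul_comm ((starRingEnd ℂ) _)]
    exact this.resolve_left (by simp)
  have key : ((∑ f, ‖∑ j, h f j‖ ^ 2 : ℝ) : ℂ) = ((∑ f, ∑ j, ‖h f j‖ ^ 2 : ℝ) : ℂ) := by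
    push_cast
    simp only [← Complex.conj_mul', map_sum, Finset.sum_mul_sum]
    rw [Finset.sum_comm, Finset.sum_comm (s := Finset.univ (α := K → Y))]
    refine Finset.sum_congr rfl fun i _ => ?_
    rw [Finset.sum_comm]
    exact Finset.sum_eq_single i (fun j _ hj => cross i j hj.symm) (by simp)
  exact_mod_cast key

/-- Without independence, Cauchy–Schwarz would cost a factor `|J|`, which with `J = R` would cancel
the gain `1/|R|` from decompression. -/
lemma sum_norm_sq_sum_sub_mean_le {J : Type*} [Fintype J] [Nonempty Y] (p : J → K)
    (hp : Function.Injective p) (g : (K → Y) → J → ℂ)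
    (hdep : ∀ j f f', f (p j) = f' (p j) → g f j = g f' j) :
    ∑ f, ‖∑ j, g f j - (∑ f', ∑ j, g f' j) / Fintype.card (K → Y)‖ ^ 2 ≤
      ∑ f, ∑ j, ‖g f j‖ ^ 2 := by
  classical
  have h1 := sum_norm_sq_sum_eq p hp
    (fun f j => g f j - (∑ f', g f' j) / Fintype.card (K → Y))
    (fun j f f' hf => by simp only [hdep j f f' hf])
    (fun j => by
      rw [Finset.sum_sub_distrib, Finset.sum_const, Finset.card_univ, nsmul_eq_mul,
        mul_div_cancel₀ _ (by simp), sub_self])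
  have h2 : ∀ f : K → Y, ∑ j, (g f j - (∑ f', g f' j) / Fintype.card (K → Y)) =
      ∑ j, g f j - (∑ f', ∑ j, g f' j) / Fintype.card (K → Y) := fun f => by
    rw [Finset.sum_sub_distrib, ← Finset.sum_div, Finset.sum_comm]
  simp only [h2] at h1
  rw [h1, Finset.sum_comm, Finset.sum_comm (s := Finset.univ (α := K → Y))]
  exact Finset.sum_le_sum fun j _ => sum_norm_sq_sub_mean_le fun f => g f j

end Independence

/-! ### Approximate invariance of subspaces. -/

section Approx

variable {E : Type*} [NormedAddCommGroup E] [InnerProductSpace ℂ E]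

/-- `T` maps the subspace `V` into the subspace `V'` up to a relative error `c`. -/
def ApproxMaps (c : ℝ) (T : E → E) (V V' : Submodule ℂ E) : Prop :=
  ∀ φ ∈ V, ∃ φ' ∈ V', ‖φ'‖ ≤ ‖φ‖ ∧ ‖T φ - φ'‖ ≤ c * ‖φ‖

variable {c d : ℝ} {S T : E → E} {V V' V'' : Submodule ℂ E}

/-- The orthogonal projection of `T φ` is at least as close as any approximant, and its norm is at
most `‖T φ‖ = ‖φ‖`. This norm bound makes errors add under composition instead of compounding. -/
lemma approxMaps_of_exists [FiniteDimensional ℂ E] (hT : ∀ φ, ‖T φ‖ = ‖φ‖)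
    (h : ∀ φ ∈ V, ∃ φ' ∈ V', ‖T φ - φ'‖ ≤ c * ‖φ‖) : ApproxMaps c T V V' := by
  intro φ hφ
  obtain ⟨φ', hφ', hc⟩ := h φ hφ
  refine ⟨V'.starProjection (T φ), Submodule.starProjection_apply_mem _ _, ?_, ?_⟩
  · exact (V'.norm_starProjection_apply_le _).trans (hT φ).le
  · rw [Submodule.starProjection_minimal]
    exact (ciInf_le ⟨0, by rintro _ ⟨x, rfl⟩; positivity⟩ (⟨φ', hφ'⟩ : V')).trans hc

lemma approxMaps_zero (h : ∀ φ ∈ V, T φ ∈ V') (hT : ∀ φ, ‖T φ‖ = ‖φ‖) :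
    ApproxMaps 0 T V V' :=
  fun φ hφ => ⟨T φ, h φ hφ, (hT φ).le, by simp⟩

lemma ApproxMaps.comp (hT : ApproxMaps c T V V') (hS : ApproxMaps d S V' V'') (hd : 0 ≤ d)
    (hiso : ∀ φ ψ, ‖S φ - S ψ‖ = ‖φ - ψ‖) : ApproxMaps (c + d) (S ∘ T) V V'' := by
  intro φ hφ
  obtain ⟨φ', hφ', hn', hc⟩ := hT φ hφ
  obtain ⟨φ'', hφ'', hn'', hd'⟩ := hS φ' hφ'
  refine ⟨φ'', hφ'', hn''.trans hn', ?_⟩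
  calc ‖S (T φ) - φ''‖ ≤ ‖S (T φ) - S φ'‖ + ‖S φ' - φ''‖ := norm_sub_le_norm_sub_add_norm_sub ..
    _ ≤ c * ‖φ‖ + d * ‖φ‖ := by
      rw [hiso]
      exact add_le_add hc (hd'.trans (mul_le_mul_of_nonneg_left hn' hd))
    _ = (c + d) * ‖φ‖ := by ring

end Approx

/-! ### Operations controlled on the function register. -/

section Lift

variable {F I : Type*} [Fintype F] [Fintype I]

/-- Controlled on the value `f` of the first register, apply `T f` to the second. -/
def lift (T : F → (I → ℂ) → I → ℂ) (Ψ : EuclideanSpace ℂ (F × I)) : EuclideanSpace ℂ (F × I) :=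
  WithLp.toLp 2 fun p => T p.1 (fun i => Ψ (p.1, i)) p.2

@[simp] lemma lift_apply (T : F → (I → ℂ) → I → ℂ) (Ψ : EuclideanSpace ℂ (F × I)) (f : F) (i : I) :
    lift T Ψ (f, i) = T f (fun i => Ψ (f, i)) i := rfl

lemma norm_lift {T : F → (I → ℂ) → I → ℂ} (hT : ∀ f ψ, ∑ i, ‖T f ψ i‖ ^ 2 = ∑ i, ‖ψ i‖ ^ 2)
    (Ψ : EuclideanSpace ℂ (F × I)) : ‖lift T Ψ‖ = ‖Ψ‖ := by
  rw [← sq_eq_sq₀ (norm_nonneg _) (norm_nonneg _), EuclideanSpace.norm_sq_eq,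
    EuclideanSpace.norm_sq_eq, Fintype.sum_prod_type, Fintype.sum_prod_type]
  exact Finset.sum_congr rfl fun f _ => hT f fun i => Ψ (f, i)

lemma norm_lift_sub_lift {T : F → (I → ℂ) → I → ℂ}
    (hT : ∀ f ψ, ∑ i, ‖T f ψ i‖ ^ 2 = ∑ i, ‖ψ i‖ ^ 2)
    (hsub : ∀ f ψ φ, T f (ψ - φ) = T f ψ - T f φ) (Ψ Φ : EuclideanSpace ℂ (F × I)) :
    ‖lift T Ψ - lift T Φ‖ = ‖Ψ - Φ‖ := by
  rw [← norm_lift hT (Ψ - Φ)]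
  congr 1
  ext ⟨f, i⟩
  exact (congrFun (hsub f (fun i => Ψ (f, i)) fun i => Φ (f, i)) i).symm

end Lift

/-! ### Purified states and the cost of decompression. -/

section Purified

variable {W X R Y : Type*} [Fintype W] [Fintype X] [DecidableEq X] [Fintype R] [DecidableEq R]
  [Fintype Y] [AddCommGroup R] [AddCommGroup Y]

variable (W X R Y) in
/-- Purified states: the first register holds the function, in the computational basis. -/
abbrev PurifiedState :=
  EuclideanSpace ℂ ((X × R → Y) × ((W × Query X Y) × Option (X × R)))

variable (W X R Y) in
/-- States in which the function is untouched if the database is empty, and is touched at `(x, r)`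
only if the database is `{(x, r)}`. -/
def compressedSpace : Submodule ℂ (PurifiedState W X R Y) where
  carrier := {Φ | (∀ a f f', Φ (f, a, none) = Φ (f', a, none)) ∧
    (∀ a x r f f', f (x, r) = f' (x, r) → Φ (f, a, some (x, r)) = Φ (f', a, some (x, r))) ∧
    -- Orthogonality to the uniform superposition at `x`, but only on average over `f`: this makes
    -- the `⊥` component of `meanDecomp` vanish.
    ∀ a x, ∑ f, ∑ r, Φ (f, a, some (x, r)) = 0}
  add_mem' := by
    rintro Φ Ψ ⟨h1, h2, h3⟩ ⟨k1, k2, k3⟩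
    refine ⟨fun a f f' => ?_, fun a x r f f' hf => ?_, fun a x => ?_⟩
    · simp [h1 a f f', k1 a f f']
    · simp [h2 a x r f f' hf, k2 a x r f f' hf]
    · simp [Finset.sum_add_distrib, h3, k3]
  zero_mem' := by simp
  smul_mem' := by
    rintro c Φ ⟨h1, h2, h3⟩
    refine ⟨fun a f f' => ?_, fun a x r f f' hf => ?_, fun a x => ?_⟩
    · simp [h1 a f f']
    · simp [h2 a x r f f' hf]
    · simp [← Finset.mul_sum, h3]

variable (W X R Y) in
/-- The analogue of `compressedSpace` for states whose database is decompressed at the queried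
input. -/
def decompressedSpace : Submodule ℂ (PurifiedState W X R Y) where
  carrier := {Φ | (∀ a f, Φ (f, a, none) = 0) ∧
    (∀ a x r f f', f (x, r) = f' (x, r) → Φ (f, a, some (x, r)) = Φ (f', a, some (x, r))) ∧
    ∀ a x, x ≠ a.2.1 → ∑ f, ∑ r, Φ (f, a, some (x, r)) = 0}
  add_mem' := by
    rintro Φ Ψ ⟨h1, h2, h3⟩ ⟨k1, k2, k3⟩
    refine ⟨fun a f => ?_, fun a x r f f' hf => ?_, fun a x hx => ?_⟩
    · simp [h1 a f, k1 a f]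
    · simp [h2 a x r f f' hf, k2 a x r f f' hf]
    · simp [Finset.sum_add_distrib, h3 a x hx, k3 a x hx]
  zero_mem' := by simp
  smul_mem' := by
    rintro c Φ ⟨h1, h2, h3⟩
    refine ⟨fun a f => ?_, fun a x r f f' hf => ?_, fun a x hx => ?_⟩
    · simp [h1 a f]
    · simp [h2 a x r f f' hf]
    · simp [← Finset.mul_sum, h3 a x hx]

/-- The total amplitude of the entries at `x`, averaged over the function. -/
def meanAmplitude (Φ : PurifiedState W X R Y) (a : W × Query X Y) (x : X) : ℂ :=
  (∑ f, ∑ r, Φ (f, a, some (x, r))) / Fintype.card (X × R → Y)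

/-- The (de)compression at the queried input, with the total amplitude replaced by its mean. -/
def meanDecomp (Φ : PurifiedState W X R Y) : PurifiedState W X R Y :=
  WithLp.toLp 2 fun
    | (_, a, none) => 1 / (Real.sqrt (Fintype.card R) : ℂ) * meanAmplitude Φ a a.2.1
    | (f, a, some (x, r)) =>
      if x = a.2.1 then 1 / (Real.sqrt (Fintype.card R) : ℂ) * Φ (f, a, none) +
        (Φ (f, a, some (x, r)) - 1 / (Fintype.card R : ℂ) * meanAmplitude Φ a x)
      else Φ (f, a, some (x, r))

lemma meanDecomp_none (Φ : PurifiedState W X R Y) (f : X × R → Y) (a : W × Query X Y) :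
    meanDecomp Φ (f, a, none) =
      1 / (Real.sqrt (Fintype.card R) : ℂ) * meanAmplitude Φ a a.2.1 := rfl

lemma meanDecomp_some (Φ : PurifiedState W X R Y) (f : X × R → Y) (a : W × Query X Y) (x : X)
    (r : R) : meanDecomp Φ (f, a, some (x, r)) =
      if x = a.2.1 then 1 / (Real.sqrt (Fintype.card R) : ℂ) * Φ (f, a, none) +
        (Φ (f, a, some (x, r)) - 1 / (Fintype.card R : ℂ) * meanAmplitude Φ a x)
      else Φ (f, a, some (x, r)) := rfl

/-- The mean amplitude does not depend on `f`, so unlike the true total amplitude it introduces no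
dependence on `f` at further points. -/
lemma meanDecomp_mem_decompressedSpace {Φ : PurifiedState W X R Y}
    (hΦ : Φ ∈ compressedSpace W X R Y) : meanDecomp Φ ∈ decompressedSpace W X R Y := by
  obtain ⟨h1, h2, h3⟩ := hΦ
  refine ⟨fun a f => ?_, fun a x r f f' hf => ?_, fun a x hx => ?_⟩
  · rw [meanDecomp_none, meanAmplitude, h3]
    simp
  · rw [meanDecomp_some, meanDecomp_some, h1 a f f', h2 a x r f f' hf]
  · simp only [meanDecomp_some, if_neg hx]
    exact h3 a x

lemma meanDecomp_mem_compressedSpace {Φ : PurifiedState W X R Y}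
    (hΦ : Φ ∈ decompressedSpace W X R Y) : meanDecomp Φ ∈ compressedSpace W X R Y := by
  obtain ⟨h1, h2, h3⟩ := hΦ
  refine ⟨fun a f f' => ?_, fun a x r f f' hf => ?_, fun a x => ?_⟩
  · rw [meanDecomp_none, meanDecomp_none]
  · rw [meanDecomp_some, meanDecomp_some, h1, h1, h2 a x r f f' hf]
  · simp only [meanDecomp_some]
    split_ifs with hx
    -- With no `⊥` component, subtracting `1/|R|` of the mean from each of the `|R|` entries removes
    -- exactly the averaged total.
    · simp only [h1, mul_zero, zero_add, Finset.sum_sub_distrib, Finset.sum_const,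
        Finset.card_univ, nsmul_eq_mul]
      rw [meanAmplitude]
      have : (Fintype.card (X × R → Y) : ℂ) ≠ 0 := by simp
      have : (Fintype.card R : ℂ) ≠ 0 := by simp
      field_simp
      ring
    · exact h3 a x hx

/-- With database `{(x, r)}` the shift uses only `f (x, r)`, the one value on which the amplitude
may already depend. -/
lemma lift_redEval_mem_decompressedSpace {Φ : PurifiedState W X R Y}
    (hΦ : Φ ∈ decompressedSpace W X R Y) :
    lift (fun f => redEval f) Φ ∈ decompressedSpace W X R Y := by
  obtain ⟨h1, h2, h3⟩ := hΦ
  refine ⟨?_, ?_, ?_⟩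
  · rintro ⟨w, x, u, b⟩ f
    exact h1 _ f
  · rintro ⟨w, x', u, b⟩ x r f f' hf
    by_cases hx : x = x'
    · subst hx
      simpa [redEval, hf] using h2 _ _ _ f f' hf
    · simpa [redEval, hx] using h2 _ _ _ f f' hf
  · rintro ⟨w, x', u, b⟩ x hx
    simpa [redEval, show x ≠ x' from hx] using h3 _ _ hx

lemma lift_applyLocal_mem_compressedSpace (U : Matrix (W × Query X Y) (W × Query X Y) ℂ)
    {Φ : PurifiedState W X R Y} (hΦ : Φ ∈ compressedSpace W X R Y) :
    lift (fun _ => applyLocal U) Φ ∈ compressedSpace W X R Y := by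
  obtain ⟨h1, h2, h3⟩ := hΦ
  refine ⟨fun a f f' => ?_, fun a x r f f' hf => ?_, fun a x => ?_⟩
  · simp only [lift_apply, applyLocal]
    exact Finset.sum_congr rfl fun a' _ => by rw [h1 a' f f']
  · simp only [lift_apply, applyLocal]
    exact Finset.sum_congr rfl fun a' _ => by rw [h2 a' x r f f' hf]
  · simp only [lift_apply, applyLocal]
    calc _ = ∑ f : X × R → Y, ∑ a', ∑ r, U a a' * Φ (f, a', some (x, r)) :=
          Finset.sum_congr rfl fun f _ => Finset.sum_comm
      _ = ∑ a', U a a' * ∑ f : X × R → Y, ∑ r, Φ (f, a', some (x, r)) := by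
          rw [Finset.sum_comm]
          simp only [Finset.mul_sum]
      _ = 0 := by simp [h3]

lemma norm_lift_redDecomp_sub_meanDecomp_le (Φ : PurifiedState W X R Y)
    (h2 : ∀ a x r (f f' : X × R → Y), f (x, r) = f' (x, r) →
      Φ (f, a, some (x, r)) = Φ (f', a, some (x, r))) :
    ‖lift (fun _ => redDecomp) Φ - meanDecomp Φ‖ ≤ Real.sqrt (2 / Fintype.card R) * ‖Φ‖ := by
  have hR : (0 : ℝ) < Fintype.card R := by simp [Fintype.card_pos]
  set N : ℝ := (Fintype.card R : ℝ) with hN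
  set δ : (X × R → Y) → (W × Query X Y) → ℂ :=
    fun f a => ∑ r, Φ (f, a, some (a.2.1, r)) - meanAmplitude Φ a a.2.1 with hδ
  set Δ := lift (fun _ => redDecomp) Φ - meanDecomp Φ with hΔ
  have hnone : ∀ f a, ‖Δ (f, a, none)‖ ^ 2 = 1 / N * ‖δ f a‖ ^ 2 := by
    intro f a
    have : Δ (f, a, none) = 1 / (Real.sqrt N : ℂ) * δ f a := by
      simp only [hΔ, PiLp.sub_apply, lift_apply, redDecomp, cellDecomp_none, meanDecomp_none,
        hδ, cell_some]
      ring
    rw [this, norm_mul, mul_pow, norm_div, norm_one, Complex.norm_real, Real.norm_eq_abs,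
      div_pow, sq_abs, Real.sq_sqrt hR.le, one_pow]
  have hsome : ∀ f a r, ‖Δ (f, a, some (a.2.1, r))‖ ^ 2 = 1 / N ^ 2 * ‖δ f a‖ ^ 2 := by
    intro f a r
    have : Δ (f, a, some (a.2.1, r)) = - (1 / (N : ℂ) * δ f a) := by
      simp only [hΔ, PiLp.sub_apply, lift_apply, redDecomp, cellDecomp_some, meanDecomp_some,
        hδ, cell_some, cell_none, if_true, hN, Complex.ofReal_natCast]
      ring
    rw [this, norm_neg, norm_mul, mul_pow, norm_div, norm_one, Complex.norm_real,
      Real.norm_eq_abs, div_pow, sq_abs, one_pow]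
  have hother : ∀ f a x r, x ≠ a.2.1 → Δ (f, a, some (x, r)) = 0 := by
    intro f a x r hx
    simp [hΔ, redDecomp, meanDecomp_some, hx]
  -- The `⊥` component contributes `1/N` and the `N` entries contribute `1/N²` each, hence `2/N`.
  have hblock : ∀ f a, ∑ d, ‖Δ (f, a, d)‖ ^ 2 = 2 / N * ‖δ f a‖ ^ 2 := by
    intro f a
    rw [sum_option_prod a.2.1, Fintype.sum_option, cell_none, hnone]
    have : ∑ x', ∑ r, (if x' = a.2.1 then 0 else ‖Δ (f, a, some (x', r))‖ ^ 2) = 0 := by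
      refine Finset.sum_eq_zero fun x _ => Finset.sum_eq_zero fun r _ => ?_
      split_ifs with hx
      · rfl
      · rw [hother f a x r hx]
        simp
    rw [this]
    simp only [cell_some, hsome, Finset.sum_const, Finset.card_univ, nsmul_eq_mul, ← hN]
    field_simp
    ring
  -- `δ` is the deviation from its mean of a sum over `r` of functions of the distinct values `f (x,
  -- r)`, with `x` the queried input.
  have hmean : ∀ a, ∑ f, ‖δ f a‖ ^ 2 ≤ ∑ f, ∑ d, ‖Φ (f, a, d)‖ ^ 2 := by
    intro a
    refine (sum_norm_sq_sum_sub_mean_le (fun r : R => (a.2.1, r)) (fun r r' h => by simpa using h)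
      (fun f r => Φ (f, a, some (a.2.1, r))) fun r f f' h => h2 _ _ _ f f' h).trans ?_
    refine Finset.sum_le_sum fun f _ => ?_
    rw [sum_option_prod a.2.1, Fintype.sum_option]
    simp only [cell_some]
    have h0 : 0 ≤ ∑ x', ∑ r, (if x' = a.2.1 then 0 else ‖Φ (f, a, some (x', r))‖ ^ 2) :=
      Finset.sum_nonneg fun x _ => Finset.sum_nonneg fun r _ => by split_ifs <;> positivity
    have h1 : 0 ≤ ‖Φ (f, a, cell a.2.1 none)‖ ^ 2 := by positivity
    linarith
  have hexpand : ∀ Ψ : PurifiedState W X R Y,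
      ‖Ψ‖ ^ 2 = ∑ a, ∑ f, ∑ d, ‖Ψ (f, a, d)‖ ^ 2 := by
    intro Ψ
    rw [EuclideanSpace.norm_sq_eq, Fintype.sum_prod_type,
      Finset.sum_comm (s := Finset.univ (α := W × Query X Y))]
    exact Finset.sum_congr rfl fun f _ =>
      Fintype.sum_prod_type fun s => ‖Ψ (f, s)‖ ^ 2
  refine (sq_le_sq₀ (norm_nonneg _) (by positivity)).1 ?_
  rw [mul_pow, Real.sq_sqrt (by positivity), hexpand, hexpand, Finset.mul_sum]
  refine Finset.sum_le_sum fun a _ => ?_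
  simp only [hblock]
  rw [← Finset.mul_sum]
  exact mul_le_mul_of_nonneg_left (hmean a) (by positivity)

end Purified

/-! ### Error accumulation over the queries and the bound on the winning probability. -/

section Bound

variable {W X R Y : Type*} [Fintype W] [Fintype X] [DecidableEq X] [Fintype R] [DecidableEq R]
  [Fintype Y] [DecidableEq Y] [AddCommGroup R] [AddCommGroup Y]

variable (W X R Y) in
/-- `redDecomp` on purified states. -/
def pureDecomp : PurifiedState W X R Y → PurifiedState W X R Y := lift fun _ => redDecomp

variable (W X R Y) in
/-- `redEval` on purified states. -/
def pureEval : PurifiedState W X R Y → PurifiedState W X R Y := lift fun f => redEval f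

/-- A unitary of the adversary on purified states. -/
def pureLocal (U : Matrix (W × Query X Y) (W × Query X Y) ℂ) :
    PurifiedState W X R Y → PurifiedState W X R Y := lift fun _ => applyLocal U

lemma norm_pureDecomp (Φ : PurifiedState W X R Y) : ‖pureDecomp W X R Y Φ‖ = ‖Φ‖ :=
  norm_lift (fun _ => sum_norm_sq_redDecomp) Φ

lemma norm_pureDecomp_sub (Φ Ψ : PurifiedState W X R Y) :
    ‖pureDecomp W X R Y Φ - pureDecomp W X R Y Ψ‖ = ‖Φ - Ψ‖ :=
  norm_lift_sub_lift (fun _ => sum_norm_sq_redDecomp) (fun _ => redDecomp_sub) Φ Ψ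

lemma norm_pureEval (Φ : PurifiedState W X R Y) : ‖pureEval W X R Y Φ‖ = ‖Φ‖ :=
  norm_lift sum_norm_sq_redEval Φ

lemma norm_pureEval_sub (Φ Ψ : PurifiedState W X R Y) :
    ‖pureEval W X R Y Φ - pureEval W X R Y Ψ‖ = ‖Φ - Ψ‖ :=
  norm_lift_sub_lift sum_norm_sq_redEval redEval_sub Φ Ψ

lemma norm_pureLocal [DecidableEq W] (U : Matrix.unitaryGroup (W × Query X Y) ℂ)
    (Φ : PurifiedState W X R Y) : ‖pureLocal (U : Matrix _ _ ℂ) Φ‖ = ‖Φ‖ :=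
  norm_lift (fun _ => sum_norm_sq_applyLocal U) Φ

lemma norm_pureLocal_sub [DecidableEq W] (U : Matrix.unitaryGroup (W × Query X Y) ℂ)
    (Φ Ψ : PurifiedState W X R Y) :
    ‖pureLocal (U : Matrix _ _ ℂ) Φ - pureLocal (U : Matrix _ _ ℂ) Ψ‖ = ‖Φ - Ψ‖ :=
  norm_lift_sub_lift (fun _ => sum_norm_sq_applyLocal U) (fun _ => applyLocal_sub _) Φ Ψ

/-- One query followed by a unitary of the adversary, on purified states. -/
def pureRound (U : Matrix (W × Query X Y) (W × Query X Y) ℂ) :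
    PurifiedState W X R Y → PurifiedState W X R Y :=
  pureLocal U ∘ pureDecomp W X R Y ∘ pureEval W X R Y ∘ pureDecomp W X R Y

lemma norm_pureRound_sub [DecidableEq W] (U : Matrix.unitaryGroup (W × Query X Y) ℂ)
    (Φ Ψ : PurifiedState W X R Y) :
    ‖pureRound (U : Matrix _ _ ℂ) Φ - pureRound (U : Matrix _ _ ℂ) Ψ‖ = ‖Φ - Ψ‖ := by
  simp only [pureRound, Function.comp_apply]
  rw [norm_pureLocal_sub, norm_pureDecomp_sub, norm_pureEval_sub, norm_pureDecomp_sub]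

/-- Only the two decompressions contribute an error; evaluation and the adversary's unitary preserve
their spaces exactly. -/
lemma approxMaps_pureRound [DecidableEq W] (U : Matrix.unitaryGroup (W × Query X Y) ℂ) :
    ApproxMaps (2 * Real.sqrt (2 / Fintype.card R)) (pureRound (U : Matrix _ _ ℂ))
      (compressedSpace W X R Y) (compressedSpace W X R Y) := by
  have h1 : ApproxMaps (Real.sqrt (2 / Fintype.card R)) (pureDecomp W X R Y)
      (compressedSpace W X R Y) (decompressedSpace W X R Y) :=
    approxMaps_of_exists norm_pureDecomp fun Φ hΦ => ⟨meanDecomp Φ,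
      meanDecomp_mem_decompressedSpace hΦ, norm_lift_redDecomp_sub_meanDecomp_le Φ hΦ.2.1⟩
  have h2 : ApproxMaps 0 (pureEval W X R Y)
      (decompressedSpace W X R Y) (decompressedSpace W X R Y) :=
    approxMaps_zero (fun _ => lift_redEval_mem_decompressedSpace) norm_pureEval
  have h3 : ApproxMaps (Real.sqrt (2 / Fintype.card R)) (pureDecomp W X R Y)
      (decompressedSpace W X R Y) (compressedSpace W X R Y) :=
    approxMaps_of_exists norm_pureDecomp fun Φ hΦ => ⟨meanDecomp Φ,
      meanDecomp_mem_compressedSpace hΦ, norm_lift_redDecomp_sub_meanDecomp_le Φ hΦ.2.1⟩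
  have h4 : ApproxMaps 0 (pureLocal (U : Matrix _ _ ℂ))
      (compressedSpace W X R Y) (compressedSpace W X R Y) :=
    approxMaps_zero (fun _ => lift_applyLocal_mem_compressedSpace _) (norm_pureLocal U)
  have := ((h1.comp h2 le_rfl norm_pureEval_sub).comp h3 (Real.sqrt_nonneg _)
    norm_pureDecomp_sub).comp h4 le_rfl (norm_pureLocal_sub U)
  rwa [add_zero, add_zero, ← two_mul] at this

/-- The joint state of the game after `t` queries, with the function in superposition (up to
normalization). -/
def Adversary.purifiedState (A : Adversary X R Y) (t : ℕ) : PurifiedState (Fin A.dim) X R Y :=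
  WithLp.toLp 2 fun p => A.redState p.1 t p.2

lemma Adversary.norm_sq_purifiedState_zero (A : Adversary X R Y) :
    ‖A.purifiedState 0‖ ^ 2 = Fintype.card (X × R → Y) := by
  have h : ∀ f : X × R → Y, ∑ s, ‖A.purifiedState 0 (f, s)‖ ^ 2 = 1 := by
    intro f
    rw [← A.init_norm, Fintype.sum_prod_type]
    refine Finset.sum_congr rfl fun a _ => ?_
    rw [Fintype.sum_option]
    simp [Adversary.purifiedState, Adversary.redState]
  rw [EuclideanSpace.norm_sq_eq, Fintype.sum_prod_type]
  simp only [h]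
  simp

lemma Adversary.purifiedState_zero_mem (A : Adversary X R Y) :
    A.purifiedState 0 ∈ compressedSpace (Fin A.dim) X R Y := by
  refine ⟨fun a f f' => ?_, fun a x r f f' _ => ?_, fun a x => ?_⟩ <;>
    simp [Adversary.purifiedState, Adversary.redState]

lemma Adversary.purifiedState_succ (A : Adversary X R Y) (t : ℕ) :
    A.purifiedState (t + 1) = pureRound (A.step t : Matrix _ _ ℂ) (A.purifiedState t) := rfl

/-- After `t` queries the purified state is close to `compressedSpace`. -/
lemma Adversary.exists_mem_compressedSpace (A : Adversary X R Y) (t : ℕ) :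
    ∃ Φ ∈ compressedSpace (Fin A.dim) X R Y, ‖Φ‖ ≤ ‖A.purifiedState 0‖ ∧
      ‖A.purifiedState t - Φ‖ ≤
        t * (2 * Real.sqrt (2 / Fintype.card R)) * ‖A.purifiedState 0‖ := by
  induction t with
  | zero => exact ⟨_, A.purifiedState_zero_mem, le_rfl, by simp⟩
  | succ t ih =>
    obtain ⟨Φ, hΦ, hn, hd⟩ := ih
    obtain ⟨Φ', hΦ', hn', hd'⟩ := approxMaps_pureRound (A.step t) Φ hΦ
    refine ⟨Φ', hΦ', hn'.trans hn, ?_⟩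
    rw [A.purifiedState_succ]
    refine (norm_sub_le_norm_sub_add_norm_sub _ (pureRound (A.step t : Matrix _ _ ℂ) Φ) _).trans ?_
    rw [norm_pureRound_sub]
    have : 2 * Real.sqrt (2 / Fintype.card R) * ‖Φ‖ ≤
        2 * Real.sqrt (2 / Fintype.card R) * ‖A.purifiedState 0‖ := by
      gcongr
    push_cast
    linarith

open Classical in
/-- In `compressedSpace`, the function is untouched at one of any two distinct points. -/
lemma card_mul_sum_wins_le {Φ : PurifiedState W X R Y} (hΦ : Φ ∈ compressedSpace W X R Y)
    (o : (X × R × Y) × (X × R × Y)) (s : (W × Query X Y) × Option (X × R)) :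
    Fintype.card Y * ∑ f, (if Wins f o then ‖Φ (f, s)‖ ^ 2 else 0) ≤ ∑ f, ‖Φ (f, s)‖ ^ 2 := by
  obtain ⟨a, d⟩ := s
  obtain ⟨h1, h2, -⟩ := hΦ
  -- At an unrecorded point `k` the amplitude does not see `f k`, so a win forces an independent
  -- event of probability `1/|Y|`.
  have key : ∀ k y, d ≠ some k → (∀ f, Wins f o → f k = y) →
      Fintype.card Y * ∑ f, (if Wins f o then ‖Φ (f, a, d)‖ ^ 2 else 0) ≤
        ∑ f, ‖Φ (f, a, d)‖ ^ 2 := by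
    intro k y hd hk
    rw [← card_mul_sum_ite k y (fun f => ‖Φ (f, a, d)‖ ^ 2)]
    · refine mul_le_mul_of_nonneg_left (Finset.sum_le_sum fun f _ => ?_) (by positivity)
      by_cases hw : Wins f o
      · simp [hw, hk f hw]
      · simp only [hw, if_false]
        split_ifs <;> positivity
    · intro f y'
      rcases d with _ | ⟨x, r⟩
      · simp only [h1 a (Function.update f k y') f]
      · rw [h2 a x r (Function.update f k y') f (Function.update_of_ne (by simpa using hd) _ _)]
  by_cases hd : d = some (o.1.1, o.1.2.1)
  · by_cases hd' : d = some (o.2.1, o.2.2.1)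
    · have hw : ∀ f, ¬ Wins f o := fun f hw => hw.1 (by simpa using hd.symm.trans hd')
      simp only [hw, if_false, Finset.sum_const_zero, mul_zero]
      positivity
    · exact key _ _ hd' fun f hw => hw.2.2
  · exact key _ _ hd fun f hw => hw.2.1

lemma Adversary.gameProb_uniform_le (A : Adversary X R Y) :
    A.gameProb (PMF.uniformOfFintype (X × R → Y)) ≤
      2 / Fintype.card Y + 16 * A.queries ^ 2 / Fintype.card R := by
  classical
  obtain ⟨Φ, hΦ, hn, hd⟩ := A.exists_mem_compressedSpace A.queries
  set Ψ := A.purifiedState A.queries with hΨ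
  set N : ℝ := (Fintype.card (X × R → Y) : ℝ) with hN
  have hNpos : 0 < N := by simp [hN, Fintype.card_pos]
  have hY : (0 : ℝ) < Fintype.card Y := by simp [Fintype.card_pos]
  have hn2 : ‖Φ‖ ^ 2 ≤ N := by
    rw [hN, ← A.norm_sq_purifiedState_zero]
    gcongr
  have hd2 : ‖Ψ - Φ‖ ^ 2 ≤ 8 * A.queries ^ 2 / Fintype.card R * N := by
    calc ‖Ψ - Φ‖ ^ 2 ≤ (A.queries * (2 * Real.sqrt (2 / Fintype.card R)) *
          ‖A.purifiedState 0‖) ^ 2 := by gcongr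
      _ = _ := by
        rw [mul_pow, A.norm_sq_purifiedState_zero, mul_pow, mul_pow,
          Real.sq_sqrt (by positivity)]
        ring
  -- The function register is only ever a control, so the game is an average over its branches;
  -- `N⁻¹` normalizes the unnormalized superposition.
  have hgame : A.gameProb (PMF.uniformOfFintype (X × R → Y)) =
      N⁻¹ * ∑ f, ∑ s, if Wins f (A.output s.1) then ‖Ψ (f, s)‖ ^ 2 else 0 := by
    rw [Adversary.gameProb, Finset.mul_sum]
    refine Finset.sum_congr rfl fun f _ => ?_
    rw [PMF.uniformOfFintype_apply, ENNReal.toReal_inv, ENNReal.toReal_natCast, A.winProb_eq]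
    congr 1
    refine Finset.sum_congr rfl fun s _ => ?_
    by_cases h : Wins f (A.output s.1) <;> simp [h, hΨ, Adversary.purifiedState]
  -- From `‖a + b‖² ≤ 2‖a‖² + 2‖b‖²`; this doubles `1/|Y|` and turns the constant `8` of `hd2` into
  -- `16`.
  have hsplit : ∀ f s, (if Wins f (A.output s.1) then ‖Ψ (f, s)‖ ^ 2 else 0) ≤
      2 * (if Wins f (A.output s.1) then ‖Φ (f, s)‖ ^ 2 else 0) + 2 * ‖(Ψ - Φ) (f, s)‖ ^ 2 := by
    intro f s
    split_ifs
    · have h := norm_add_le (Φ (f, s)) ((Ψ - Φ) (f, s))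
      rw [PiLp.sub_apply, add_sub_cancel] at h
      rw [PiLp.sub_apply]
      nlinarith [sq_nonneg (‖Φ (f, s)‖ - ‖Ψ (f, s) - Φ (f, s)‖), norm_nonneg (Ψ (f, s)),
        norm_nonneg (Φ (f, s)), norm_nonneg (Ψ (f, s) - Φ (f, s))]
    · positivity
  have hideal : ∑ f, ∑ s, (if Wins f (A.output s.1) then ‖Φ (f, s)‖ ^ 2 else 0) ≤
      N / Fintype.card Y := by
    rw [le_div_iff₀ hY, mul_comm, Finset.sum_comm, Finset.mul_sum]
    refine (Finset.sum_le_sum fun s _ => card_mul_sum_wins_le hΦ (A.output s.1) s).trans ?_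
    rw [Finset.sum_comm, ← Fintype.sum_prod_type' fun f s => ‖Φ (f, s)‖ ^ 2]
    exact (EuclideanSpace.norm_sq_eq Φ).symm.le.trans hn2
  have hdiff : ∑ f, ∑ s, ‖(Ψ - Φ) (f, s)‖ ^ 2 ≤ 8 * A.queries ^ 2 / Fintype.card R * N := by
    rw [← Fintype.sum_prod_type' fun f s => ‖(Ψ - Φ) (f, s)‖ ^ 2]
    exact (EuclideanSpace.norm_sq_eq (Ψ - Φ)).symm.le.trans hd2
  rw [hgame, inv_mul_le_iff₀ hNpos]
  calc _ ≤ ∑ f, ∑ s, (2 * (if Wins f (A.output s.1) then ‖Φ (f, s)‖ ^ 2 else 0) +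
        2 * ‖(Ψ - Φ) (f, s)‖ ^ 2) :=
        Finset.sum_le_sum fun f _ => Finset.sum_le_sum fun s _ => hsplit f s
    _ ≤ 2 * (N / Fintype.card Y) + 2 * (8 * A.queries ^ 2 / Fintype.card R * N) := by
        simp only [Finset.sum_add_distrib, ← Finset.mul_sum]
        gcongr
    _ = _ := by ring

end Bound

/-! ### Negligible functions. -/

section Negligible

lemma negligible_one_div {g : ℕ → ℕ} (hg : Superpolynomial g) :
    Negligible fun n => 1 / (g n : ℝ) := by
  intro k
  refine squeeze_zero' (Eventually.of_forall fun n => by positivity) ?_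
    tendsto_one_div_atTop_nhds_zero_nat
  -- One degree more than `k` leaves `n ^ k / g n ≤ 1 / n`.
  filter_upwards [hg (Polynomial.X ^ (k + 1)), eventually_gt_atTop 0] with n hn hpos
  simp only [Polynomial.eval_pow, Polynomial.eval_X] at hn
  have hn' : (n : ℝ) ^ (k + 1) ≤ g n := by exact_mod_cast hn.le
  have hp : (0 : ℝ) < n := by exact_mod_cast hpos
  have hgp : (0 : ℝ) < g n := (by positivity : (0 : ℝ) < (n : ℝ) ^ (k + 1)).trans_le hn'
  rw [mul_one_div, div_le_div_iff₀ hgp hp, one_mul, ← pow_succ]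
  exact hn'

lemma negligible_one_div_two_pow : Negligible fun n => 1 / (2 : ℝ) ^ n := by
  intro k
  simpa [div_eq_mul_inv] using tendsto_pow_const_div_const_pow_of_one_lt k (one_lt_two (α := ℝ))

end Negligible

end SEQ

end

theorem mainTheorem5 {X R Y : ℕ → Type*}
    [∀ n, Fintype (X n)] [∀ n, DecidableEq (X n)]
    [∀ n, Fintype (R n)] [∀ n, DecidableEq (R n)]
    [∀ n, Fintype (Y n)] [∀ n, DecidableEq (Y n)]
    [∀ n, AddCommGroup (R n)] [∀ n, AddCommGroup (Y n)]
    (hR : ∀ n, Fintype.card (R n) = 2 ^ n)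
    (hY : SEQ.Superpolynomial (fun n => Fintype.card (Y n))) :
    SEQ.Unlearnable (fun n => PMF.uniformOfFintype (X n × R n → Y n)) := by
  rintro A ⟨p, hp⟩
  -- The bound `p` replaces the number of queries, so the second term is a polynomial times `2⁻ⁿ`.
  refine ⟨fun n => 2 * (1 / (Fintype.card (Y n) : ℝ)) +
    (16 * (p.map (Nat.castRingHom ℝ)) ^ 2).eval (n : ℝ) * (1 / (2 : ℝ) ^ n), ?_, fun n => ?_⟩
  · exact ((SEQ.negligible_one_div hY).const_mul 2).add
      (SEQ.negligible_one_div_two_pow.polynomial_mul _)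
  · have hq : ((A n).queries : ℝ) ≤ (p.map (Nat.castRingHom ℝ)).eval (n : ℝ) := by
      rw [Polynomial.eval_natCast_map, eq_natCast]
      exact_mod_cast hp n
    refine (A n).gameProb_uniform_le.trans ?_
    rw [hR]
    push_cast
    rw [mul_one_div, Polynomial.eval_mul, Polynomial.eval_pow, Polynomial.eval_ofNat, mul_one_div]
    gcongr
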